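/- Theorem. Let $m\ge 1$. For $L,j\in\mathbb{N}_0^m$ put $j_{m+1}:=0$; call $j$ *$L$-compatible* if $j_i\le L_i+j_{i+1}$ for all $i=1,\dots,m$, and in that case let $\mathrm{Inv}(L,j)$ denote a random variable with probability generating function $$\prod_{i=1}^m \binom{L_i+j_{i+1}}{j_i}_{\!q}\Big/\binom{L_i+j_{i+1}}{j_i},$$ where $\binom{n}{k}_q$ is the $q$-binomial coefficient. Let $(\mathbf L^{(N)})_N$ be a sequence in $\mathbb{N}_0^m$. For each $N$ let $\mathbf J^{(N)}$ be a random vector in $\mathbb N_0^m$ that is almost surely $\mathbf L^{(N)}$-compatible, and let $Y^{(N)}$ be an $\mathbb{N}_0$-valued random variable on the same probability space (which may depend on $N$) such that $\mathbb P(Y^{(N)}=i\mid \mathbf J^{(N)}=j)=\mathbb P(\mathrm{Inv}(\mathbf L^{(N)},j)=i)$ for all $i\in\mathbb N_0$ and all $j$ with $\mathbb P(\mathbf J^{(N)}=j)>0$. Put $R^{(N)}=Y^{(N)}-\mathbb E(Y^{(N)}\mid \mathbf J^{(N)})$. Suppose that $\frac1N\mathbf L^{(N)}\to\mathbf a\ne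 0$ and that there are $\mathbf b\in\mathbb R^m$ with all $b_i\ge 0$ and a positive semidefinite $\Sigma\in\mathbb R^{m\times m}$ of positive rank such that $$\frac{\mathbf J^{(N)}-N\mathbf b}{\sqrt N}\ \xrightarrow{\;d\;}\ \mathcal N(\mathbf 0,\Sigma).$$ With $b_{m+1}:=0$ let $$v(\mathbf a,\mathbf b)=\frac1{12}\sum_{i=1}^m (a_i+b_{i+1}-b_i)\,b_i\,(a_i+b_{i+1}).$$ Then $v(\mathbf a,\mathbf b)\ge 0$, and as $N\to\infty$ $$\Big(\frac{R^{(N)}}{N^{3/2}},\ \frac{\mathbf J^{(N)}-N\mathbf b}{\sqrt N}\Big)\ \xrightarrow{\;d\;}\ \big(R(\mathbf a,\mathbf b),\,\mathbf G\big),$$ where $R(\mathbf a,\mathbf b)\sim\mathcal N(0,v(\mathbf a,\mathbf b))$ and $\mathbf G\sim\mathcal N(\mathbf 0,\Sigma)$ are independent, and $\mathcal N(0,0)$ means the point mass at $0$. -/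

import Mathlib

open MeasureTheory ProbabilityTheory Filter Topology Polynomial

noncomputable section

namespace Supernomial

/-- The `q`-factorial `[n]_q! = ∏_{i=1}^n (1 + q + ⋯ + q^{i-1})`, as a polynomial in `q = X`. -/
def qFactorial (n : ℕ) : ℕ[X] :=
  ∏ i ∈ Finset.range n, ∑ k ∈ Finset.range (i + 1), (X : ℕ[X]) ^ k

/-- The `q`-binomial coefficient `[n choose k]_q`, as a polynomial in `q = X`, given by the
`q`-Pascal rule. It is `[n]_q! / ([k]_q! [n-k]_q!)` for `k ≤ n`, see `qBinom_mul_qFactorial`, and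
`0` for `k > n`, see `qBinom_eq_zero`. -/
def qBinom : ℕ → ℕ → ℕ[X]
  | _, 0 => 1
  | 0, _ + 1 => 0
  | n + 1, k + 1 => qBinom n k + X ^ (k + 1) * qBinom n (k + 1)

theorem qBinom_eq_zero (n k : ℕ) (h : n < k) : qBinom n k = 0 := by
  induction n generalizing k with
  | zero =>
    obtain ⟨k, rfl⟩ := Nat.exists_eq_succ_of_ne_zero (by omega : k ≠ 0)
    simp [qBinom]
  | succ n ih =>
    obtain ⟨k, rfl⟩ := Nat.exists_eq_succ_of_ne_zero (by omega : k ≠ 0)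
    simp [qBinom, ih k (by omega), ih (k + 1) (by omega)]

theorem qFactorial_succ (n : ℕ) :
    qFactorial (n + 1) = qFactorial n * ∑ k ∈ Finset.range (n + 1), (X : ℕ[X]) ^ k := by
  simp [qFactorial, Finset.prod_range_succ]

theorem qBinom_mul_qFactorial (a b : ℕ) :
    qBinom (a + b) a * (qFactorial a * qFactorial b) = qFactorial (a + b) := by
  induction hn : a + b generalizing a b with
  | zero =>
    obtain ⟨rfl, rfl⟩ : a = 0 ∧ b = 0 := by omega
    simp [qBinom, qFactorial]
  | succ n ih =>
    rcases a with _ | a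
    · obtain rfl : b = n + 1 := by omega
      simp [qBinom, qFactorial]
    · have h1 := ih a b (by omega)
      have hs : ∑ k ∈ Finset.range (n + 1), (X : ℕ[X]) ^ k
          = ∑ k ∈ Finset.range (a + 1), (X : ℕ[X]) ^ k
            + X ^ (a + 1) * ∑ k ∈ Finset.range b, (X : ℕ[X]) ^ k := by
        rw [show n + 1 = (a + 1) + b by omega, Finset.sum_range_add, Finset.mul_sum]
        simp [pow_add]
      have h2 : qBinom n (a + 1) * (qFactorial (a + 1) * qFactorial b)
          = qFactorial n * ∑ k ∈ Finset.range b, (X : ℕ[X]) ^ k := by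
        rcases b with _ | b
        · simp [qBinom_eq_zero n (a + 1) (by omega)]
        · have := ih (a + 1) b (by omega)
          rw [qFactorial_succ b, ← this]
          ring
      rw [qBinom, add_mul, mul_assoc (X ^ (a + 1)), h2, qFactorial_succ n, qFactorial_succ a, hs,
        mul_add, ← h1]
      ring

theorem eval_one_qBinom (n k : ℕ) : (qBinom n k).eval 1 = n.choose k := by
  induction n generalizing k with
  | zero => cases k <;> simp [qBinom]
  | succ n ih => cases k <;> simp [qBinom, ih, Nat.choose_succ_succ]

/-- For `x = (x_1, …, x_m)`, the shifted entry `x_{i+1}`, with the convention `x_{m+1} = 0`. -/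
def shift {α : Type*} [Zero α] {m : ℕ} (x : Fin m → α) (i : Fin m) : α :=
  if h : (i : ℕ) + 1 < m then x ⟨i + 1, h⟩ else 0

/-- `j` is compatible to the admission vector `L`: `j_i ≤ L_i + j_{i+1}` for all `i`. -/
def Compatible {m : ℕ} (L j : Fin m → ℕ) : Prop :=
  ∀ i, j i ≤ L i + shift j i

/-- The probability generating function of `Inv(L, j)`, i.e. the product over `i` of the
normalized `q`-binomials `[L_i + j_{i+1} choose j_i]_q / (L_i + j_{i+1} choose j_i)`. -/
def invPGF {m : ℕ} (L j : Fin m → ℕ) : ℝ[X] :=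
  ∏ i, C (((L i + shift j i).choose (j i) : ℝ)⁻¹) *
    (qBinom (L i + shift j i) (j i)).map (Nat.castRingHom ℝ)

/-- For compatible `j`, the coefficients of `invPGF L j` sum to `1`. -/
theorem eval_one_invPGF {m : ℕ} {L j : Fin m → ℕ} (h : Compatible L j) :
    (invPGF L j).eval 1 = 1 := by
  rw [invPGF, eval_prod]
  refine Finset.prod_eq_one fun i _ => ?_
  have h1 : ((qBinom (L i + shift j i) (j i)).map (Nat.castRingHom ℝ)).eval 1
      = ((L i + shift j i).choose (j i) : ℝ) := by
    rw [eval_one_map, eval_one_qBinom]; simp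
  rw [eval_mul, eval_C, h1]
  exact inv_mul_cancel₀ (by exact_mod_cast (Nat.choose_pos (h i)).ne')

/-- `Y` is an inversion statistic for `L` with mixing vector `J`, on the probability space
`(Ω, P)`: almost surely `J` is `L`-compatible, and given `J = j` the variable `Y` is distributed
as `Inv(L, j)`. -/
structure IsInversionStatistic {m : ℕ} {Ω : Type*} [MeasurableSpace Ω] (P : Measure Ω)
    (L : Fin m → ℕ) (J : Ω → Fin m → ℕ) (Y : Ω → ℕ) : Prop where
  measurable_mixing : Measurable J
  measurable_stat : Measurable Y
  compatible : ∀ᵐ ω ∂P, Compatible L (J ω)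
  cond_law : ∀ j : Fin m → ℕ, P (J ⁻¹' {j}) ≠ 0 → ∀ i : ℕ,
    (P[|J ⁻¹' {j}]).real (Y ⁻¹' {i}) = (invPGF L j).coeff i

/-- The rest-inversion part `R = Y - 𝔼(Y | J)`. -/
def restInversion {m : ℕ} {Ω : Type*} [MeasurableSpace Ω] (P : Measure Ω)
    (J : Ω → Fin m → ℕ) (Y : Ω → ℕ) (ω : Ω) : ℝ :=
  (Y ω : ℝ) - (P[fun ω' => (Y ω' : ℝ) | MeasurableSpace.comap J inferInstance]) ω

/-- The limiting variance
`v(a, b) = (1/12) ∑ᵢ (a_i + b_{i+1} - b_i) b_i (a_i + b_{i+1})`, with `b_{m+1} = 0`. -/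
def limVar {m : ℕ} (a b : Fin m → ℝ) : ℝ :=
  (1 / 12) * ∑ i, (a i + shift b i - b i) * b i * (a i + shift b i)

/-- The normalized mixing vector `(J - N b) / √N`. -/
def normalizedMixing {m : ℕ} {Ω : Type*} (N : ℕ) (b : Fin m → ℝ) (J : Ω → Fin m → ℕ) (ω : Ω) :
    EuclideanSpace ℝ (Fin m) :=
  WithLp.toLp 2 fun i => ((J ω i : ℝ) - N * b i) / √(N : ℝ)

end Supernomial

end

/-!
The proof goes through characteristic functions. At `q = exp (i s)` one has
`1 + q + ⋯ + q ^ (r - 1) = exp (i s (r - 1) / 2) * r * sinc (r s / 2) / sinc (s / 2)`, so that up to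
normalization the `q`-binomial coefficient is
`exp (i s k (n - k) / 2) * ∏_{r ≤ n} sinc (r s / 2) / (∏_{r ≤ k} ⋯ * ∏_{r ≤ n - k} ⋯)`
(`eval₂_qBinom_exp`). The phase is that of the mean `k (n - k) / 2`, and `log (sinc u)` is
`- u ^ 2 / 6 + O (u ^ 4)`. For `s = t / N ^ (3/2)` and `n, k = O(N)` the quadratic terms add up to
`- t ^ 2 / 2` times the variance `k (n - k) (n + 1) / 12` divided by `N ^ 3`, while the error is
`O (1 / N)`. Hence the characteristic function of the centred and scaled `Inv(L, j)` converges to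
that of `𝒩(0, limVar a b)` whenever `L / N → a` and `j / N → b` (`tendsto_invCharFun`),
including the degenerate case `limVar a b = 0`.

For the random vector `J`, convergence in distribution of `(J - N b) / √N` gives tightness, hence
`J / N → b` in probability (`tendsto_measure_of_mem_mixingFilter`). Since `𝔼(Y | J)` is the mean of
`Inv(L, J)` (`IsInversionStatistic.condExp_ae_eq`), conditioning on `J` turns the joint
characteristic function of the rest-inversion part and the normalized mixing vector into the
expectation of the former's conditional characteristic function times a bounded function of `J`
(`charFun_map_restInversion_prod`). The first factor converges in probability to a constant and
is bounded by one, so the joint characteristic function converges to a product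
(`tendsto_integral_sub_of_tendsto_mixingFilter`), and Lévy's continuity theorem concludes.
-/

namespace Supernomial

/-! ### The cardinal sine near zero -/

theorem abs_sinc_sub_le {u : ℝ} (hu : |u| ≤ 1) :
    |Real.sinc u - (1 - u ^ 2 / 6)| ≤ u ^ 4 / 100 := by
  rcases eq_or_ne u 0 with rfl | h0
  · simp
  · have h := Real.sin_bound hu
    have h1 : Real.sinc u - (1 - u ^ 2 / 6) = (Real.sin u - (u - u ^ 3 / 6)) / u := by
      rw [Real.sinc_of_ne_zero h0]
      field_simp
    have h4 : |u| ^ 4 = u ^ 4 := Even.pow_abs (by decide) u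
    rw [h1, abs_div, div_le_iff₀ (abs_pos.2 h0), ← h4]
    linarith [show |u| ^ 4 / 100 * |u| = |u| ^ 5 / 100 by ring]

theorem abs_sinc_sub_one_le {u : ℝ} (hu : |u| ≤ 1) : |Real.sinc u - 1| ≤ u ^ 2 / 4 := by
  have h := abs_le.1 (abs_sinc_sub_le hu)
  have hu2 : u ^ 2 ≤ 1 := (sq_le_one_iff_abs_le_one u).2 hu
  have h4 : u ^ 4 ≤ u ^ 2 := by nlinarith [sq_nonneg u]
  rw [abs_le]
  constructor <;> nlinarith [sq_nonneg u]

theorem sinc_pos_of_abs_le_one {u : ℝ} (hu : |u| ≤ 1) : 0 < Real.sinc u := by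
  have h := abs_le.1 (abs_sinc_sub_one_le hu)
  have hu2 : u ^ 2 ≤ 1 := (sq_le_one_iff_abs_le_one u).2 hu
  linarith

theorem abs_log_sinc_add_le {u : ℝ} (hu : |u| ≤ 1) :
    |Real.log (Real.sinc u) + u ^ 2 / 6| ≤ u ^ 4 := by
  set w := 1 - Real.sinc u with hw
  have hu2 : u ^ 2 ≤ 1 := (sq_le_one_iff_abs_le_one u).2 hu
  have hw1 : |w| ≤ u ^ 2 / 4 := by
    rw [hw, abs_sub_comm]
    exact abs_sinc_sub_one_le hu
  have hlog := Real.abs_log_sub_add_sum_range_le (x := w) (by linarith) 1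
  have hs : 1 - w = Real.sinc u := by rw [hw]; ring
  rw [hs] at hlog
  simp only [Finset.range_one, Finset.sum_singleton, zero_add, pow_one, Nat.cast_zero, div_one,
    one_add_one_eq_two] at hlog
  have h6 : 0 ≤ u ^ 4 := by positivity
  have h2 : |w| ^ 2 / (1 - |w|) ≤ u ^ 4 / 12 := by
    rw [div_le_iff₀ (by linarith)]
    have h4 : |w| ^ 2 ≤ (u ^ 2 / 4) ^ 2 := pow_le_pow_left₀ (abs_nonneg _) hw1 2
    nlinarith
  have h3 := abs_sinc_sub_le hu
  calc |Real.log (Real.sinc u) + u ^ 2 / 6|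
      = |(w + Real.log (Real.sinc u)) + (Real.sinc u - (1 - u ^ 2 / 6))| := by
        congr 1
        rw [hw]
        ring
    _ ≤ u ^ 4 / 12 + u ^ 4 / 100 := (abs_add_le _ _).trans (by linarith)
    _ ≤ u ^ 4 := by linarith

/-- The logarithm of `∏_{r=1}^n sinc (r s / 2)`, which is up to a phase and a normalization the
`q`-factorial `[n]_q!` at `q = exp (i s)`. -/
noncomputable def logSincSum (n : ℕ) (s : ℝ) : ℝ :=
  ∑ i ∈ Finset.range n, Real.log (Real.sinc ((i + 1) * s / 2))

theorem abs_half_mul_le {n i : ℕ} (s : ℝ) (hi : i < n) :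
    |((i : ℝ) + 1) * s / 2| ≤ n * |s| / 2 := by
  have h1 : ((i : ℝ) + 1) ≤ n := by exact_mod_cast hi
  rw [abs_div, abs_mul, abs_of_nonneg (by positivity : (0 : ℝ) ≤ (i : ℝ) + 1),
    abs_of_pos (by norm_num : (0 : ℝ) < 2)]
  have := mul_le_mul_of_nonneg_right h1 (abs_nonneg s)
  linarith

theorem exp_logSincSum {n : ℕ} {s : ℝ} (hs : n * |s| ≤ 1) :
    Real.exp (logSincSum n s) = ∏ i ∈ Finset.range n, Real.sinc ((i + 1) * s / 2) := by
  rw [logSincSum, Real.exp_sum]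
  refine Finset.prod_congr rfl fun i hi => Real.exp_log (sinc_pos_of_abs_le_one ?_)
  linarith [abs_half_mul_le s (Finset.mem_range.1 hi)]

theorem abs_logSincSum_add_le {n : ℕ} {s : ℝ} (hs : n * |s| ≤ 1) :
    |logSincSum n s + s ^ 2 / 144 * (n * (n + 1) * (2 * n + 1))| ≤ n * (n * |s|) ^ 4 := by
  have hsum : ∀ n : ℕ, s ^ 2 / 144 * (n * (n + 1) * (2 * n + 1))
      = ∑ i ∈ Finset.range n, ((i + 1) * s / 2) ^ 2 / 6 := by
    intro n
    induction n with
    | zero => simp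
    | succ n ih =>
      rw [Finset.sum_range_succ, ← ih]
      push_cast
      ring
  rw [hsum, logSincSum, ← Finset.sum_add_distrib]
  calc |∑ i ∈ Finset.range n, (Real.log (Real.sinc ((i + 1) * s / 2)) + ((i + 1) * s / 2) ^ 2 / 6)|
      ≤ ∑ i ∈ Finset.range n, (n * |s|) ^ 4 := by
        refine (Finset.abs_sum_le_sum_abs _ _).trans (Finset.sum_le_sum fun i hi => ?_)
        have h := abs_half_mul_le s (Finset.mem_range.1 hi)
        have h0 : 0 ≤ n * |s| := by positivity
        refine (abs_log_sinc_add_le (by linarith)).trans ?_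
        rw [← Even.pow_abs (by decide : Even 4)]
        exact pow_le_pow_left₀ (abs_nonneg _) (by linarith) 4
    _ = n * (n * |s|) ^ 4 := by simp

/-! ### The `q`-binomial coefficient on the unit circle -/

/-- The `q`-integer `[r]_q` at `q = exp (i s)`. The factor `sinc (s / 2)` is kept on the left so
that the identity includes `s = 0`. -/
theorem sum_exp_pow_mul_sinc (s : ℝ) (r : ℕ) :
    (∑ k ∈ Finset.range r, Complex.exp (Complex.I * s) ^ k) * (Real.sinc (s / 2) : ℂ)
      = Complex.exp (Complex.I * s * (((r : ℂ) - 1) / 2)) * (r * (Real.sinc (r * s / 2) : ℂ)) := by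
  rcases eq_or_ne s 0 with rfl | h0
  · simp
  rcases eq_or_ne r 0 with rfl | hr
  · simp
  have hsc : (s : ℂ) ≠ 0 := by exact_mod_cast h0
  have hrc : (r : ℂ) ≠ 0 := by exact_mod_cast hr
  have hrs : (r : ℝ) * s / 2 ≠ 0 := by positivity
  have hs2 : s / 2 ≠ 0 := by positivity
  have key : ∀ x : ℂ, Complex.exp (Complex.I * x) - 1
      = Complex.exp (Complex.I * (x / 2)) * (2 * Complex.I * Complex.sin (x / 2)) := by
    intro x
    have h1 : Complex.exp (Complex.I * x) = Complex.exp (Complex.I * (x / 2)) ^ 2 := by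
      rw [← Complex.exp_nat_mul]
      congr 1
      push_cast
      ring
    have h2 : Complex.exp (-(x / 2) * Complex.I) * Complex.exp (Complex.I * (x / 2)) = 1 := by
      rw [← Complex.exp_add, ← Complex.exp_zero]
      congr 1
      ring
    rw [h1, Complex.sin, mul_comm (x / 2) Complex.I]
    linear_combination h2 -
      (Complex.exp (-(x / 2) * Complex.I) - Complex.exp (Complex.I * (x / 2))) *
        Complex.exp (Complex.I * (x / 2)) * Complex.I_sq
  have hg := geom_sum_mul (Complex.exp (Complex.I * s)) r
  have hpow : Complex.exp (Complex.I * s) ^ r = Complex.exp (Complex.I * (r * s)) := by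
    rw [← Complex.exp_nat_mul]
    congr 1
    ring
  rw [hpow, key, key] at hg
  rw [Real.sinc_of_ne_zero hs2, Real.sinc_of_ne_zero hrs]
  have hsplit : Complex.exp (Complex.I * (r * s / 2))
      = Complex.exp (Complex.I * s * (((r : ℂ) - 1) / 2)) * Complex.exp (Complex.I * (s / 2)) := by
    rw [← Complex.exp_add]
    congr 1
    ring
  rw [hsplit] at hg
  push_cast
  have hne := Complex.exp_ne_zero (Complex.I * (s / 2))
  have hI := Complex.I_ne_zero
  have h3 : (∑ k ∈ Finset.range r, Complex.exp (Complex.I * s) ^ k) * Complex.sin (s / 2)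
      = Complex.exp (Complex.I * s * (((r : ℂ) - 1) / 2)) * Complex.sin (r * s / 2) := by
    refine mul_right_cancel₀ (mul_ne_zero (mul_ne_zero two_ne_zero hI) hne) ?_
    linear_combination hg
  rw [show ∀ A B : ℂ, A * (B / (s / 2)) = A * B * (2 / s) from fun A B => by ring, h3]
  have h4 : (r : ℂ) * (Complex.sin (r * s / 2) / (r * s / 2))
      = Complex.sin (r * s / 2) * (2 / s) := by
    field_simp
  rw [h4, mul_assoc]

theorem eval₂_qFactorial_mul {n : ℕ} {s : ℝ} (hs : n * |s| ≤ 1) :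
    (qFactorial n).eval₂ (Nat.castRingHom ℂ) (Complex.exp (Complex.I * s)) *
        (Real.sinc (s / 2) : ℂ) ^ n
      = n.factorial * Complex.exp (Complex.I * s * ((n : ℂ) * (n - 1) / 4)) *
        Complex.exp (logSincSum n s) := by
  rw [← Complex.ofReal_exp, exp_logSincSum hs]
  clear hs
  induction n with
  | zero => simp [qFactorial]
  | succ n ih =>
    have h := sum_exp_pow_mul_sinc s (n + 1)
    rw [qFactorial_succ, eval₂_mul, eval₂_finsetSum, pow_succ, Finset.prod_range_succ,
      Nat.factorial_succ]
    simp only [eval₂_pow, eval₂_X]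
    rw [mul_mul_mul_comm, ih, h]
    push_cast
    have he : Complex.exp (Complex.I * s * (((n : ℂ) + 1) * (n + 1 - 1) / 4))
        = Complex.exp (Complex.I * s * ((n : ℂ) * (n - 1) / 4)) *
          Complex.exp (Complex.I * s * (((n : ℂ) + 1 - 1) / 2)) := by
      rw [← Complex.exp_add]
      congr 1
      ring
    rw [he]
    ring

/-- At `q = exp (i s)` with `s` small, the `q`-binomial coefficient is a phase times a positive
real number. The phase `k (n - k) / 2` is the mean of the inversion statistic, so the real number
is, up to normalization, the characteristic function of the centred statistic. -/
theorem eval₂_qBinom_exp {n k : ℕ} (hk : k ≤ n) {s : ℝ} (hs : n * |s| ≤ 1) :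
    (qBinom n k).eval₂ (Nat.castRingHom ℂ) (Complex.exp (Complex.I * s))
      = n.choose k * Complex.exp (Complex.I * s * ((k : ℂ) * (n - k) / 2)) *
        Complex.exp (logSincSum n s - logSincSum k s - logSincSum (n - k) s) := by
  obtain ⟨l, rfl⟩ := Nat.exists_eq_add_of_le hk
  have hkl : ((k + l : ℕ) : ℝ) = k + l := by push_cast; ring
  have hs' := hs
  rw [hkl] at hs'
  have hks : (k : ℝ) * |s| ≤ 1 := by nlinarith [abs_nonneg s, (Nat.cast_nonneg l : (0 : ℝ) ≤ l)]
  have hls : (l : ℝ) * |s| ≤ 1 := by nlinarith [abs_nonneg s, (Nat.cast_nonneg k : (0 : ℝ) ≤ k)]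
  have h := congrArg (fun p : ℕ[X] =>
    p.eval₂ (Nat.castRingHom ℂ) (Complex.exp (Complex.I * s)) * (Real.sinc (s / 2) : ℂ) ^ (k + l))
    (qBinom_mul_qFactorial k l)
  simp only [eval₂_mul] at h
  rw [eval₂_qFactorial_mul hs, pow_add, mul_assoc, mul_mul_mul_comm, eval₂_qFactorial_mul hks,
    eval₂_qFactorial_mul hls] at h
  have hfact : ((k + l).factorial : ℂ) = (k + l).choose k * k.factorial * l.factorial := by
    rw [← Nat.add_choose_mul_factorial_mul_factorial k l, Nat.choose_symm_add]
    push_cast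
    ring
  have he : Complex.exp (Complex.I * s * (((k + l : ℕ) : ℂ) * ((k + l : ℕ) - 1) / 4))
      = Complex.exp (Complex.I * s * ((k : ℂ) * ((k + l : ℕ) - k) / 2)) *
        (Complex.exp (Complex.I * s * ((k : ℂ) * (k - 1) / 4)) *
        Complex.exp (Complex.I * s * ((l : ℂ) * (l - 1) / 4))) := by
    rw [← Complex.exp_add, ← Complex.exp_add]
    congr 1
    push_cast
    ring
  rw [hfact, he] at h
  rw [Nat.add_sub_cancel_left, Complex.exp_sub, Complex.exp_sub]
  have n1 := Complex.exp_ne_zero (Complex.I * s * ((k : ℂ) * (k - 1) / 4))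
  have n2 := Complex.exp_ne_zero (Complex.I * s * ((l : ℂ) * (l - 1) / 4))
  have n3 := Complex.exp_ne_zero (logSincSum k s : ℂ)
  have n4 := Complex.exp_ne_zero (logSincSum l s : ℂ)
  have n5 : (k.factorial : ℂ) ≠ 0 := by exact_mod_cast k.factorial_ne_zero
  have n6 : (l.factorial : ℂ) ≠ 0 := by exact_mod_cast l.factorial_ne_zero
  rw [div_div, mul_div_assoc', eq_div_iff (mul_ne_zero n3 n4)]
  refine mul_right_cancel₀ (mul_ne_zero (mul_ne_zero n5 n6) (mul_ne_zero n1 n2)) ?_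
  linear_combination h

/-! ### Asymptotics of the logarithm of a `q`-binomial coefficient -/

/-- The quadratic terms of the three sums combine to the variance `k (n - k) (n + 1) / 12` of the
inversion statistic. -/
theorem abs_logSincSum_sub_add_le {n k : ℕ} (hk : k ≤ n) {s : ℝ} (hs : n * |s| ≤ 1) :
    |(logSincSum n s - logSincSum k s - logSincSum (n - k) s)
        + s ^ 2 / 24 * (k * (n - k) * (n + 1))| ≤ 3 * (n * (n * |s|) ^ 4) := by
  obtain ⟨l, rfl⟩ := Nat.exists_eq_add_of_le hk
  have hle : ∀ i : ℕ, i ≤ k + l → |logSincSum i s + s ^ 2 / 144 * (i * (i + 1) * (2 * i + 1))|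
      ≤ (k + l : ℕ) * ((k + l : ℕ) * |s|) ^ 4 := by
    intro i hi
    have hi' : (i : ℝ) ≤ (k + l : ℕ) := by exact_mod_cast hi
    have his : (i : ℝ) * |s| ≤ (k + l : ℕ) * |s| := mul_le_mul_of_nonneg_right hi' (abs_nonneg s)
    refine (abs_logSincSum_add_le (his.trans hs)).trans ?_
    gcongr
  have h1 := abs_le.1 (hle (k + l) le_rfl)
  have h2 := abs_le.1 (hle k (by omega))
  have h3 := abs_le.1 (hle l (by omega))
  rw [Nat.add_sub_cancel_left]
  have hid : s ^ 2 / 24 * ((k : ℝ) * ((k + l : ℕ) - k) * ((k + l : ℕ) + 1))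
      = s ^ 2 / 144 * ((k + l : ℕ) * ((k + l : ℕ) + 1) * (2 * (k + l : ℕ) + 1))
        - s ^ 2 / 144 * (k * (k + 1) * (2 * k + 1))
        - s ^ 2 / 144 * (l * (l + 1) * (2 * l + 1)) := by
    push_cast
    ring
  rw [hid, abs_le]
  constructor <;> linarith

theorem rpow_three_halves_sq {x : ℝ} (hx : 0 ≤ x) : (x ^ (3 / 2 : ℝ)) ^ 2 = x ^ 3 := by
  rw [← Real.rpow_natCast, ← Real.rpow_mul hx, ← Real.rpow_natCast]
  norm_num

section Limit

variable {ι : Type*} {l : Filter ι} {N n k : ι → ℕ} {x y : ℝ}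

theorem tendsto_mul_abs_div_rpow_three_halves (hN : Tendsto N l atTop)
    (hn : Tendsto (fun i => (n i : ℝ) / N i) l (𝓝 x)) (t : ℝ) :
    Tendsto (fun i => n i * |t / (N i : ℝ) ^ (3 / 2 : ℝ)|) l (𝓝 0) := by
  have hinv : Tendsto (fun i => ((N i : ℝ) ^ (1 / 2 : ℝ))⁻¹) l (𝓝 0) :=
    ((tendsto_rpow_atTop (by norm_num)).comp
      (tendsto_natCast_atTop_atTop.comp hN)).inv_tendsto_atTop
  have h := (hn.mul_const |t|).mul hinv
  rw [mul_zero] at h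
  refine h.congr' ?_
  filter_upwards [hN.eventually_gt_atTop 0] with i hi
  have hi' : (0 : ℝ) < N i := by exact_mod_cast hi
  have hp : (N i : ℝ) ^ (3 / 2 : ℝ) = N i * (N i : ℝ) ^ (1 / 2 : ℝ) := by
    rw [← Real.rpow_one_add' hi'.le (by norm_num)]
    norm_num
  rw [hp, abs_div, abs_of_pos (by positivity : 0 < (N i : ℝ) * (N i : ℝ) ^ (1 / 2 : ℝ))]
  field_simp

/-- With `n` and `k` of order `N`, the sum of `log sinc` over the factors of the `q`-binomial
coefficient is asymptotically quadratic in `t`, the cubic growth of the variance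
`k (n - k) (n + 1) / 12` being absorbed by the scaling `N ^ (3/2)`. -/
theorem tendsto_logSincSum_sub (hN : Tendsto N l atTop)
    (hn : Tendsto (fun i => (n i : ℝ) / N i) l (𝓝 x))
    (hk : Tendsto (fun i => (k i : ℝ) / N i) l (𝓝 y)) (hkn : ∀ᶠ i in l, k i ≤ n i) (t : ℝ) :
    Tendsto (fun i => logSincSum (n i) (t / (N i : ℝ) ^ (3 / 2 : ℝ))
      - logSincSum (k i) (t / (N i : ℝ) ^ (3 / 2 : ℝ))
      - logSincSum (n i - k i) (t / (N i : ℝ) ^ (3 / 2 : ℝ))) l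
      (𝓝 (-(t ^ 2 / 24 * ((x - y) * y * x)))) := by
  have hNinv : Tendsto (fun i => ((N i : ℝ))⁻¹) l (𝓝 0) :=
    (tendsto_natCast_atTop_atTop.comp hN).inv_tendsto_atTop
  have hsmall := tendsto_mul_abs_div_rpow_three_halves hN hn t
  set s : ι → ℝ := fun i => t / (N i : ℝ) ^ (3 / 2 : ℝ) with hs
  have hs2 : ∀ i, s i ^ 2 = t ^ 2 / (N i : ℝ) ^ 3 := fun i => by
    rw [hs, div_pow, rpow_three_halves_sq (Nat.cast_nonneg _)]
  have hmain : Tendsto (fun i => s i ^ 2 / 24 * (k i * (n i - k i) * (n i + 1))) l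
      (𝓝 (t ^ 2 / 24 * (y * (x - y) * (x + 0)))) := by
    refine (((hk.mul (hn.sub hk)).mul (hn.add hNinv)).const_mul (t ^ 2 / 24)).congr' ?_
    filter_upwards [hN.eventually_gt_atTop 0] with i hi
    have hi' : (0 : ℝ) < N i := by exact_mod_cast hi
    rw [hs2]
    field_simp
  have herr : Tendsto (fun i => 3 * (n i * (n i * |s i|) ^ 4)) l (𝓝 0) := by
    have h := ((hn.pow 5).mul_const (3 * t ^ 4)).mul hNinv
    rw [mul_zero] at h
    refine h.congr' ?_
    filter_upwards [hN.eventually_gt_atTop 0] with i hi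
    have hi' : (0 : ℝ) < N i := by exact_mod_cast hi
    rw [mul_pow, Even.pow_abs (by decide : Even 4), show s i ^ 4 = (s i ^ 2) ^ 2 by ring, hs2]
    field_simp
  have hzero : Tendsto (fun i => (logSincSum (n i) (s i) - logSincSum (k i) (s i)
      - logSincSum (n i - k i) (s i)) + s i ^ 2 / 24 * (k i * (n i - k i) * (n i + 1))) l
      (𝓝 0) := by
    refine squeeze_zero_norm' ?_ herr
    filter_upwards [hkn, hsmall.eventually_le_const one_pos] with i hi hi'
    exact abs_logSincSum_sub_add_le hi hi'
  have h := hzero.sub hmain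
  refine (h.congr fun i => ?_).trans_eq ?_
  · ring
  · congr 1
    ring

end Limit

/-! ### Mean and characteristic function of `Inv(L, j)` -/

variable {m : ℕ}

/-- The mean `∑ᵢ k_i (n_i - k_i) / 2`, with `n_i = L_i + j_{i+1}` and `k_i = j_i`, of the
distribution `Inv(L, j)`. -/
noncomputable def invMean (L j : Fin m → ℕ) : ℝ :=
  ∑ i, (j i : ℝ) * ((L i + shift j i : ℕ) - j i) / 2

theorem eval_one_derivative_qBinom (n k : ℕ) :
    (((derivative (qBinom n k)).eval 1 : ℕ) : ℝ) = n.choose k * (k * (n - k) / 2 : ℝ) := by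
  induction n generalizing k with
  | zero => cases k <;> simp [qBinom]
  | succ n ih =>
    cases k with
    | zero => simp [qBinom]
    | succ k =>
      have h1 : ((n : ℝ) + 1) * n.choose k = (n + 1).choose (k + 1) * (k + 1) := by
        exact_mod_cast Nat.add_one_mul_choose_eq n k
      have h2 : ((n + 1).choose (k + 1) : ℝ) = n.choose k + n.choose (k + 1) := by
        exact_mod_cast Nat.choose_succ_succ n k
      rw [qBinom, derivative_add, derivative_mul, derivative_X_pow]
      simp only [eval_add, eval_mul, eval_pow, eval_X, one_pow, eval_C, eval_one_qBinom,
        one_mul, mul_one, Nat.cast_add, Nat.cast_mul, ih]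
      push_cast
      linear_combination (-1 / 2) * h1 - (((k : ℝ) + 1) * (n - k + 1) / 2) * h2

theorem eval_one_normalized_qBinom {n k : ℕ} (h : k ≤ n) :
    (C ((n.choose k : ℝ)⁻¹) * (qBinom n k).map (Nat.castRingHom ℝ)).eval 1 = 1 := by
  rw [eval_mul, eval_C, eval_one_map, eval_one_qBinom]
  exact inv_mul_cancel₀ (by exact_mod_cast (Nat.choose_pos h).ne')

theorem eval_derivative_prod_of_eval_eq_one {ι R : Type*} [CommRing R] (s : Finset ι)
    (f : ι → R[X]) (x : R) (h : ∀ i ∈ s, (f i).eval x = 1) :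
    (derivative (∏ i ∈ s, f i)).eval x = ∑ i ∈ s, (derivative (f i)).eval x := by
  classical
  rw [derivative_prod_finset, eval_finsetSum]
  refine Finset.sum_congr rfl fun i _ => ?_
  rw [eval_mul, eval_prod,
    Finset.prod_eq_one fun k hk => h k (Finset.mem_of_mem_erase hk), one_mul]

theorem eval_one_derivative_invPGF {L j : Fin m → ℕ} (h : Compatible L j) :
    (derivative (invPGF L j)).eval 1 = invMean L j := by
  rw [invPGF, eval_derivative_prod_of_eval_eq_one _ _ _
    fun i _ => eval_one_normalized_qBinom (h i), invMean]
  refine Finset.sum_congr rfl fun i _ => ?_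
  rw [derivative_C_mul, derivative_map, eval_mul, eval_C, eval_one_map]
  simp only [eq_natCast]
  rw [eval_one_derivative_qBinom, inv_mul_cancel_left₀]
  exact_mod_cast (Nat.choose_pos (h i)).ne'

/-- The characteristic function at `s` of the centred distribution `Inv(L, j)`. -/
noncomputable def invCharFun (L j : Fin m → ℕ) (s : ℝ) : ℂ :=
  (invPGF L j).eval₂ Complex.ofRealHom (Complex.exp (Complex.I * s)) *
    Complex.exp (-(Complex.I * s * invMean L j))

/-- For small `s` the mean cancels the phases of the `q`-binomial coefficients, which leaves a
positive real number. -/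
theorem invCharFun_eq {L j : Fin m → ℕ} (h : Compatible L j) {s : ℝ}
    (hs : ∀ i, (L i + shift j i : ℕ) * |s| ≤ 1) :
    invCharFun L j s = Complex.exp (∑ i, (logSincSum (L i + shift j i) s - logSincSum (j i) s
      - logSincSum (L i + shift j i - j i) s) : ℝ) := by
  have hfac : ∀ i, (C (((L i + shift j i).choose (j i) : ℝ)⁻¹) *
      (qBinom (L i + shift j i) (j i)).map (Nat.castRingHom ℝ)).eval₂ Complex.ofRealHom
        (Complex.exp (Complex.I * s))
      = Complex.exp (Complex.I * s * ((j i : ℝ) * ((L i + shift j i : ℕ) - j i) / 2 : ℝ)) *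
        Complex.exp (logSincSum (L i + shift j i) s - logSincSum (j i) s
          - logSincSum (L i + shift j i - j i) s) := by
    intro i
    have hc : (((L i + shift j i).choose (j i) : ℕ) : ℂ) ≠ 0 := by
      exact_mod_cast (Nat.choose_pos (h i)).ne'
    rw [eval₂_mul, eval₂_C, eval₂_map,
      show Complex.ofRealHom.comp (Nat.castRingHom ℝ) = Nat.castRingHom ℂ from
        Subsingleton.elim _ _, eval₂_qBinom_exp (h i) (hs i)]
    simp only [map_inv₀, map_natCast]
    rw [mul_assoc, inv_mul_cancel_left₀ hc]
    push_cast
    rfl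
  rw [invCharFun, invPGF, eval₂_finsetProd, Finset.prod_congr rfl fun i _ => hfac i,
    Finset.prod_mul_distrib, ← Complex.exp_sum, ← Complex.exp_sum, mul_right_comm,
    ← Complex.exp_add, ← Finset.mul_sum, invMean, Complex.ofReal_sum, add_neg_cancel,
    Complex.exp_zero, one_mul]
  push_cast
  rfl

/-! ### Asymptotics of the characteristic function of `Inv(L, j)` -/

theorem tendsto_shift {ι : Type*} {l : Filter ι} {N : ι → ℕ} {j : ι → Fin m → ℕ} {b : Fin m → ℝ}
    (hj : ∀ k, Tendsto (fun i => (j i k : ℝ) / N i) l (𝓝 (b k))) (k : Fin m) :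
    Tendsto (fun i => ((shift (j i) k : ℕ) : ℝ) / N i) l (𝓝 (shift b k)) := by
  by_cases h : (k : ℕ) + 1 < m
  · simpa [shift, h] using hj ⟨k + 1, h⟩
  · simpa [shift, h] using tendsto_const_nhds

/-- If `L / N → a` and `j / N → b`, then the centred distribution `Inv(L, j)`, divided by
`N ^ (3/2)`, has asymptotically the characteristic function of a centred normal distribution of
variance `limVar a b`. -/
theorem tendsto_invCharFun {ι : Type*} {l : Filter ι} {N : ι → ℕ} {L j : ι → Fin m → ℕ}
    {a b : Fin m → ℝ} (hN : Tendsto N l atTop)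
    (hL : ∀ k, Tendsto (fun i => (L i k : ℝ) / N i) l (𝓝 (a k)))
    (hj : ∀ k, Tendsto (fun i => (j i k : ℝ) / N i) l (𝓝 (b k)))
    (hc : ∀ᶠ i in l, Compatible (L i) (j i)) (t : ℝ) :
    Tendsto (fun i => invCharFun (L i) (j i) (t / (N i : ℝ) ^ (3 / 2 : ℝ))) l
      (𝓝 (Complex.exp (-(t ^ 2 * limVar a b / 2) : ℝ))) := by
  have hn : ∀ k, Tendsto (fun i => ((L i k + shift (j i) k : ℕ) : ℝ) / N i) l
      (𝓝 (a k + shift b k)) := fun k =>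
    ((hL k).add (tendsto_shift hj k)).congr fun i => by push_cast; ring
  have hsum := tendsto_finsetSum Finset.univ fun k _ =>
    tendsto_logSincSum_sub hN (hn k) (hj k) (hc.mono fun i hi => hi k) t
  have hlim : ∑ k, -(t ^ 2 / 24 * ((a k + shift b k - b k) * b k * (a k + shift b k)))
      = -(t ^ 2 * limVar a b / 2) := by
    rw [limVar, Finset.sum_neg_distrib, ← Finset.mul_sum]
    ring
  rw [hlim] at hsum
  refine ((Complex.continuous_exp.comp Complex.continuous_ofReal).continuousAt.tendsto.comp
    hsum).congr' ?_
  have hsmall : ∀ᶠ i in l, ∀ k,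
      (L i k + shift (j i) k : ℕ) * |t / (N i : ℝ) ^ (3 / 2 : ℝ)| ≤ 1 :=
    eventually_all.2 fun k =>
      (tendsto_mul_abs_div_rpow_three_halves hN (hn k) t).eventually_le_const one_pos
  filter_upwards [hc, hsmall] with i hi hi'
  exact (invCharFun_eq hi hi').symm

/-! ### Laws on `ℕ` given by a probability generating polynomial -/

section DiscreteLaw

variable {Ω : Type*} [MeasurableSpace Ω] {μ : Measure Ω} {Y : Ω → ℕ} {p : ℝ[X]}

theorem ae_le_natDegree_of_law [IsFiniteMeasure μ]
    (hp : ∀ i, μ.real (Y ⁻¹' {i}) = p.coeff i) : ∀ᵐ ω ∂μ, Y ω ≤ p.natDegree := by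
  have h : ∀ i, ∀ᵐ ω ∂μ, p.natDegree < i → Y ω ≠ i := by
    intro i
    by_cases hi : p.natDegree < i
    · have h0 : μ (Y ⁻¹' {i}) = 0 := by
        rw [← measureReal_eq_zero_iff, hp, coeff_eq_zero_of_natDegree_lt hi]
      filter_upwards [measure_eq_zero_iff_ae_notMem.1 h0] with ω hω _ using hω
    · exact Eventually.of_forall fun ω h => absurd h hi
  filter_upwards [ae_all_iff.2 h] with ω hω
  by_contra! hlt
  exact hω _ hlt rfl

theorem integral_comp_eq_sum_of_law [IsFiniteMeasure μ] (hY : Measurable Y)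
    (hp : ∀ i, μ.real (Y ⁻¹' {i}) = p.coeff i) {E : Type*} [NormedAddCommGroup E]
    [NormedSpace ℝ E] [CompleteSpace E] (g : ℕ → E) :
    ∫ ω, g (Y ω) ∂μ = ∑ i ∈ Finset.range (p.natDegree + 1), p.coeff i • g i := by
  have hle : ∀ᵐ i ∂(μ.map Y), i ≤ p.natDegree :=
    (ae_map_iff hY.aemeasurable (measurableSet_Iic (a := p.natDegree))).2
      (ae_le_natDegree_of_law hp)
  have hint : Integrable g (μ.map Y) := by
    refine Integrable.of_bound .of_discrete
      (∑ i ∈ Finset.range (p.natDegree + 1), ‖g i‖) ?_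
    filter_upwards [hle] with i hi
    exact Finset.single_le_sum (f := fun i => ‖g i‖) (fun _ _ => norm_nonneg _)
      (Finset.mem_range.2 (Nat.lt_succ_of_le hi))
  rw [← integral_map hY.aemeasurable hint.aestronglyMeasurable, integral_countable hint,
    tsum_eq_sum (s := Finset.range (p.natDegree + 1))]
  · refine Finset.sum_congr rfl fun i _ => ?_
    rw [map_measureReal_apply hY (measurableSet_singleton i), hp]
  · intro i hi
    rw [map_measureReal_apply hY (measurableSet_singleton i), hp,
      coeff_eq_zero_of_natDegree_lt (by simpa [Nat.lt_succ_iff] using hi), zero_smul]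

theorem integral_eq_eval_one_derivative_of_law [IsFiniteMeasure μ] (hY : Measurable Y)
    (hp : ∀ i, μ.real (Y ⁻¹' {i}) = p.coeff i) :
    ∫ ω, (Y ω : ℝ) ∂μ = (derivative p).eval 1 := by
  rw [integral_comp_eq_sum_of_law hY hp (fun i => (i : ℝ)), derivative_eval, sum_over_range]
  · simp
  · simp

theorem integral_pow_eq_eval₂_of_law [IsFiniteMeasure μ] (hY : Measurable Y)
    (hp : ∀ i, μ.real (Y ⁻¹' {i}) = p.coeff i) (z : ℂ) :
    ∫ ω, z ^ Y ω ∂μ = p.eval₂ Complex.ofRealHom z := by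
  rw [integral_comp_eq_sum_of_law hY hp (fun i => z ^ i), eval₂_eq_sum_range]
  simp [Complex.real_smul]

end DiscreteLaw

/-! ### Conditioning on the mixing vector -/

theorem setIntegral_eq_measureReal_smul_integral_cond {Ω E : Type*} [MeasurableSpace Ω]
    [NormedAddCommGroup E] [NormedSpace ℝ E] {P : Measure Ω} [IsFiniteMeasure P] {s : Set Ω}
    (hs : P s ≠ 0) (f : Ω → E) :
    ∫ ω in s, f ω ∂P = P.real s • ∫ ω, f ω ∂(P[|s]) := by
  have h : P.real s ≠ 0 := by rwa [Ne, measureReal_eq_zero_iff]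
  rw [ProbabilityTheory.cond, integral_smul_measure, ENNReal.toReal_inv, ← measureReal_def,
    smul_inv_smul₀ h]

theorem integral_congr_of_setIntegral_fiber {Ω α E : Type*} [MeasurableSpace Ω]
    [MeasurableSpace α] [MeasurableSingletonClass α] [Countable α] [NormedAddCommGroup E]
    [NormedSpace ℝ E] {P : Measure Ω} {J : Ω → α} (hJ : Measurable J) {f g : Ω → E}
    (hf : Integrable f P) (hg : Integrable g P)
    (h : ∀ j, ∫ ω in J ⁻¹' {j}, f ω ∂P = ∫ ω in J ⁻¹' {j}, g ω ∂P) :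
    ∫ ω, f ω ∂P = ∫ ω, g ω ∂P := by
  have hm : ∀ j, MeasurableSet (J ⁻¹' {j}) := fun j => hJ (measurableSet_singleton j)
  have hd : Pairwise (Function.onFun Disjoint fun j => J ⁻¹' {j}) := fun i j hij =>
    Disjoint.preimage J (Set.disjoint_singleton.2 hij)
  have hU : ⋃ j, J ⁻¹' {j} = Set.univ := by
    rw [← Set.preimage_iUnion, Set.iUnion_of_singleton, Set.preimage_univ]
  rw [← setIntegral_univ (μ := P) (f := f), ← setIntegral_univ (μ := P) (f := g), ← hU,
    integral_iUnion hm hd hf.integrableOn, integral_iUnion hm hd hg.integrableOn]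
  exact tsum_congr h

theorem finite_setOf_compatible (L : Fin m → ℕ) : {j | Compatible L j}.Finite := by
  refine (Set.finite_Iic fun _ : Fin m => ∑ k, L k).subset fun j hj => ?_
  -- Solving the constraints from the last coordinate upwards gives `j_i ≤ L_i + ⋯ + L_m`.
  have key : ∀ d : ℕ, ∀ i : Fin m, m = (i : ℕ) + d → j i ≤ ∑ k ∈ Finset.Ici i, L k := by
    intro d
    induction d with
    | zero => intro i hi; omega
    | succ d ih =>
      intro i hi
      refine (hj i).trans ?_
      rw [← Finset.Ioi_insert, Finset.sum_insert (by simp)]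
      refine Nat.add_le_add_left ?_ _
      unfold shift
      split_ifs with h
      · refine (ih ⟨i + 1, h⟩ (by simp; omega)).trans
          (Finset.sum_le_sum_of_subset fun k hk => ?_)
        simp only [Finset.mem_Ici, Fin.le_def] at hk
        simp only [Finset.mem_Ioi, Fin.lt_def]
        omega
      · exact Nat.zero_le _
  exact fun i => (key (m - i) i (by omega)).trans
    (Finset.sum_le_sum_of_subset (Finset.subset_univ _))

section Conditioning

variable {Ω α : Type*} [MeasurableSpace Ω] {P : Measure Ω} {L : Fin m → ℕ} {J : Ω → Fin m → ℕ}
  {Y : Ω → ℕ}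

theorem of_ae_of_measure_fiber_ne_zero {X : Ω → α} {p : α → Prop} (h : ∀ᵐ ω ∂P, p (X ω)) {x : α}
    (hx : P (X ⁻¹' {x}) ≠ 0) : p x := by
  by_contra hp
  refine hx (measure_mono_null (fun ω hω => ?_) (ae_iff.1 h))
  rw [Set.mem_preimage, Set.mem_singleton_iff] at hω
  rwa [Set.mem_ofPred_eq, hω]

theorem ae_of_forall_measure_fiber_ne_zero [Countable α] {X : Ω → α} {q : α → Ω → Prop}
    (h : ∀ x, P (X ⁻¹' {x}) ≠ 0 → ∀ᵐ ω ∂P, X ω = x → q x ω) : ∀ᵐ ω ∂P, q (X ω) ω := by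
  have hall : ∀ x, ∀ᵐ ω ∂P, X ω = x → q x ω := by
    intro x
    by_cases hx : P (X ⁻¹' {x}) = 0
    · filter_upwards [measure_eq_zero_iff_ae_notMem.1 hx] with ω hω hω' using absurd hω' hω
    · exact h x hx
  filter_upwards [ae_all_iff.2 hall] with ω hω using hω _ rfl

theorem norm_exp_I_mul_mul (s x : ℝ) : ‖Complex.exp (Complex.I * s * x)‖ = 1 := by
  rw [show Complex.I * s * x = ((s * x : ℝ) : ℂ) * Complex.I by push_cast; ring,
    Complex.norm_exp_ofReal_mul_I]

theorem IsInversionStatistic.integral_cond_exp [IsFiniteMeasure P]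
    (h : IsInversionStatistic P L J Y) {j : Fin m → ℕ} (hj : P (J ⁻¹' {j}) ≠ 0) (s : ℝ) :
    ∫ ω, Complex.exp (Complex.I * s * ((Y ω : ℝ) - invMean L j : ℝ)) ∂(P[|J ⁻¹' {j}])
      = invCharFun L j s := by
  have := cond_isProbabilityMeasure hj
  rw [invCharFun, ← integral_pow_eq_eval₂_of_law h.measurable_stat (h.cond_law j hj),
    ← integral_mul_const]
  congr 1 with ω
  rw [← Complex.exp_nat_mul, ← Complex.exp_add]
  congr 1
  push_cast
  ring

variable [IsFiniteMeasure P]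

/-- Integrability of `Y` is what makes the conditional expectation in `restInversion` genuine. It
holds because only finitely many `j` are compatible, so that `Y` is almost surely bounded. -/
theorem IsInversionStatistic.integrable (h : IsInversionStatistic P L J Y) :
    Integrable (fun ω => (Y ω : ℝ)) P := by
  have hdeg : ∀ᵐ ω ∂P, Y ω ≤ (invPGF L (J ω)).natDegree := by
    refine ae_of_forall_measure_fiber_ne_zero (q := fun j ω => Y ω ≤ (invPGF L j).natDegree)
      fun j hj => ?_
    have h1 := ae_le_natDegree_of_law (h.cond_law j hj)
    rw [ProbabilityTheory.cond, Measure.ae_ennreal_smul_measure_iff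
      (ENNReal.inv_ne_zero.2 (measure_ne_top _ _)),
      ae_restrict_iff' (h.measurable_mixing (measurableSet_singleton j))] at h1
    exact h1
  have hfin := finite_setOf_compatible L
  refine Integrable.of_bound (C := ∑ j ∈ hfin.toFinset, ((invPGF L j).natDegree : ℝ))
    (measurable_from_top.comp h.measurable_stat).aestronglyMeasurable ?_
  filter_upwards [hdeg, h.compatible] with ω hω hc
  rw [Real.norm_of_nonneg (Nat.cast_nonneg _)]
  calc (Y ω : ℝ) ≤ (invPGF L (J ω)).natDegree := by exact_mod_cast hω
    _ ≤ _ := Finset.single_le_sum (f := fun j => ((invPGF L j).natDegree : ℝ))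
      (fun _ _ => Nat.cast_nonneg _) (hfin.mem_toFinset.2 hc)

theorem IsInversionStatistic.condExp_ae_eq (h : IsInversionStatistic P L J Y) :
    P[fun ω => (Y ω : ℝ) | MeasurableSpace.comap J inferInstance]
      =ᵐ[P] fun ω => invMean L (J ω) := by
  have hle := h.measurable_mixing.comap_le
  obtain ⟨f, -, hfJ⟩ := (stronglyMeasurable_condExp (m := MeasurableSpace.comap J inferInstance)
    (μ := P) (f := fun ω => (Y ω : ℝ))).measurable.exists_eq_measurable_comp
  -- The conditional expectation is a function of `J`, whose value at `j` is found by integrating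
  -- over `{J = j}`.
  have hatom : ∀ j, P (J ⁻¹' {j}) ≠ 0 → f j = invMean L j := by
    intro j hj
    have hm : MeasurableSet[MeasurableSpace.comap J inferInstance] (J ⁻¹' {j}) :=
      ⟨{j}, measurableSet_singleton j, rfl⟩
    have h1 := setIntegral_condExp hle h.integrable hm
    have h2 : ∫ ω in J ⁻¹' {j},
          (P[fun ω => (Y ω : ℝ) | MeasurableSpace.comap J inferInstance]) ω ∂P
        = ∫ ω in J ⁻¹' {j}, f j ∂P := by
      refine setIntegral_congr_fun (hle _ hm) fun ω hω => ?_
      rw [hfJ]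
      exact congrArg f hω
    have := cond_isProbabilityMeasure hj
    rw [h2, setIntegral_const, setIntegral_eq_measureReal_smul_integral_cond hj,
      integral_eq_eval_one_derivative_of_law h.measurable_stat (h.cond_law j hj),
      eval_one_derivative_invPGF (of_ae_of_measure_fiber_ne_zero h.compatible hj)] at h1
    exact smul_right_injective ℝ (by rwa [Ne, measureReal_eq_zero_iff]) h1
  rw [hfJ]
  exact ae_of_forall_measure_fiber_ne_zero (q := fun j _ => f j = invMean L j)
    fun j hj => Eventually.of_forall fun _ _ => hatom j hj

theorem IsInversionStatistic.norm_invCharFun_le (h : IsInversionStatistic P L J Y)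
    {j : Fin m → ℕ} (hj : P (J ⁻¹' {j}) ≠ 0) (s : ℝ) : ‖invCharFun L j s‖ ≤ 1 := by
  have := cond_isProbabilityMeasure hj
  rw [← h.integral_cond_exp hj]
  refine (norm_integral_le_of_norm_le_const (C := 1) (Eventually.of_forall fun ω => ?_)).trans ?_
  · rw [norm_exp_I_mul_mul]
  · simp

theorem IsInversionStatistic.ae_norm_invCharFun_le (h : IsInversionStatistic P L J Y) (s : ℝ) :
    ∀ᵐ ω ∂P, ‖invCharFun L (J ω) s‖ ≤ 1 :=
  ae_of_forall_measure_fiber_ne_zero (q := fun j _ => ‖invCharFun L j s‖ ≤ 1)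
    fun _ hj => Eventually.of_forall fun _ _ => h.norm_invCharFun_le hj s

/-- In a joint characteristic function of the rest-inversion part and the mixing vector, the
former may be integrated out conditionally on the latter. -/
theorem IsInversionStatistic.integral_exp_restInversion_mul (h : IsInversionStatistic P L J Y)
    (s : ℝ) {g : (Fin m → ℕ) → ℂ} (hg : ∀ j, ‖g j‖ ≤ 1) :
    ∫ ω, Complex.exp (Complex.I * s * restInversion P J Y ω) * g (J ω) ∂P
      = ∫ ω, invCharFun L (J ω) s * g (J ω) ∂P := by
  have hJ := h.measurable_mixing
  have hYm : Measurable fun ω => (Y ω : ℝ) := measurable_from_top.comp h.measurable_stat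
  have hcomp : ∀ {E : Type} [MeasurableSpace E] (φ : (Fin m → ℕ) → E),
      Measurable fun ω => φ (J ω) :=
    fun φ => (measurable_of_countable φ).comp hJ
  have hae : (fun ω => Complex.exp (Complex.I * s * restInversion P J Y ω) * g (J ω)) =ᵐ[P]
      fun ω => Complex.exp (Complex.I * s * ((Y ω : ℝ) - invMean L (J ω) : ℝ)) * g (J ω) := by
    filter_upwards [h.condExp_ae_eq] with ω hω
    rw [restInversion, hω]
  rw [integral_congr_ae hae]
  refine integral_congr_of_setIntegral_fiber hJ ?_ ?_ fun j => ?_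
  · refine Integrable.of_bound (C := 1) ?_ (Eventually.of_forall fun ω => ?_)
    · have h1 := hcomp (invMean L)
      have h2 := hcomp g
      exact Measurable.aestronglyMeasurable (by fun_prop)
    · rw [norm_mul, norm_exp_I_mul_mul, one_mul]
      exact hg _
  · refine Integrable.of_bound (C := 1)
      (hcomp fun j => invCharFun L j s * g j).aestronglyMeasurable ?_
    filter_upwards [h.ae_norm_invCharFun_le s] with ω hω
    rw [norm_mul]
    exact mul_le_one₀ hω (norm_nonneg _) (hg _)
  · have hm : MeasurableSet (J ⁻¹' {j}) := hJ (measurableSet_singleton j)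
    by_cases hj : P (J ⁻¹' {j}) = 0
    · rw [setIntegral_measure_zero _ hj, setIntegral_measure_zero _ hj]
    · have := cond_isProbabilityMeasure hj
      have h1 : ∫ ω in J ⁻¹' {j}, Complex.exp (Complex.I * s * ((Y ω : ℝ) - invMean L (J ω) : ℝ)) *
            g (J ω) ∂P
          = ∫ ω in J ⁻¹' {j}, Complex.exp (Complex.I * s * ((Y ω : ℝ) - invMean L j : ℝ)) *
            g j ∂P := by
        refine setIntegral_congr_fun hm fun ω hω => ?_
        have hω' : J ω = j := hω
        simp only [hω']
      have h2 : ∫ ω in J ⁻¹' {j}, invCharFun L (J ω) s * g (J ω) ∂P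
          = ∫ ω in J ⁻¹' {j}, invCharFun L j s * g j ∂P := by
        refine setIntegral_congr_fun hm fun ω hω => ?_
        have hω' : J ω = j := hω
        simp only [hω']
      rw [h1, h2, setIntegral_eq_measureReal_smul_integral_cond hj, integral_mul_const,
        h.integral_cond_exp hj, setIntegral_const]

end Conditioning

/-! ### Concentration of the mixing vector -/

/-- A sequence which converges in distribution is tight, hence stochastically bounded. -/
theorem tendsto_measure_lt_norm_of_tendstoInDistribution {E : Type*} [NormedAddCommGroup E]
    [InnerProductSpace ℝ E] [FiniteDimensional ℝ E] [MeasurableSpace E] [BorelSpace E]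
    {Ω : ℕ → Type*} [∀ N, MeasurableSpace (Ω N)] {P : ∀ N, Measure (Ω N)}
    [∀ N, IsProbabilityMeasure (P N)] {Ω' : Type*} [MeasurableSpace Ω'] {P' : Measure Ω'}
    [IsProbabilityMeasure P'] {X : ∀ N, Ω N → E} {Z : Ω' → E}
    (h : TendstoInDistribution X atTop Z P P') {c : ℕ → ℝ} (hc : Tendsto c atTop atTop) :
    Tendsto (fun N => P N {ω | c N < ‖X N ω‖}) atTop (𝓝 0) := by
  have := Measure.isProbabilityMeasure_map (μ := P') h.aemeasurable_limit
  have hp := fun N => Measure.isProbabilityMeasure_map (μ := P N) (h.forall_aemeasurable N)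
  have htight : IsTightMeasureSet (Set.range fun N => (P N).map (X N)) :=
    isTightMeasureSet_of_tendsto_charFun (f := charFun (P'.map Z))
      (by fun_prop) fun t => ProbabilityMeasure.tendsto_iff_tendsto_charFun.1 h.tendsto t
  refine tendsto_of_tendsto_of_tendsto_of_le_of_le tendsto_const_nhds
    ((tendsto_measure_compl_closedBall_of_isTightMeasureSet htight 0).comp hc)
    (fun _ => zero_le) fun N => ?_
  have hset : {ω | c N < ‖X N ω‖} = X N ⁻¹' (Metric.closedBall 0 (c N))ᶜ := by
    ext ω
    simp
  rw [hset, ← Measure.map_apply_of_aemeasurable (h.forall_aemeasurable N)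
    Metric.isClosed_closedBall.measurableSet.compl]
  exact le_iSup₂ (f := fun μ (_ : μ ∈ Set.range fun N => (P N).map (X N)) =>
    μ (Metric.closedBall 0 (c N))ᶜ) _ (Set.mem_range_self N)

/-- The filter on pairs `(N, j)` which describes the regime `N → ∞` and `j / N → b`, where `j` is
compatible to `L N`. -/
noncomputable def mixingFilter (L : ℕ → Fin m → ℕ) (b : Fin m → ℝ) : Filter (ℕ × (Fin m → ℕ)) :=
  comap Prod.fst atTop ⊓ comap (fun p k => (p.2 k : ℝ) / p.1) (𝓝 b) ⊓
    𝓟 {p | Compatible (L p.1) p.2}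

theorem abs_div_sub_le_norm_normalizedMixing {Ω : Type*} {N : ℕ} (hN : 0 < N) (b : Fin m → ℝ)
    (J : Ω → Fin m → ℕ) (ω : Ω) (k : Fin m) :
    √(N : ℝ) * |(J ω k : ℝ) / N - b k| ≤ ‖normalizedMixing N b J ω‖ := by
  have hN' : (0 : ℝ) < N := by exact_mod_cast hN
  have hs : 0 < √(N : ℝ) := Real.sqrt_pos.2 hN'
  refine le_trans (le_of_eq ?_) (PiLp.norm_apply_le (normalizedMixing N b J ω) k)
  rw [normalizedMixing, PiLp.toLp_apply, Real.norm_eq_abs, abs_div, abs_of_pos hs,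
    eq_div_iff hs.ne', mul_right_comm, Real.mul_self_sqrt hN'.le, ← abs_of_pos hN', ← abs_mul,
    abs_of_pos hN', mul_sub, mul_div_cancel₀ _ hN'.ne']

section Sequence

variable {Ω : ℕ → Type*} [∀ N, MeasurableSpace (Ω N)] {P : ∀ N, Measure (Ω N)}
  [∀ N, IsProbabilityMeasure (P N)] {L : ℕ → Fin m → ℕ} {J : ∀ N, Ω N → Fin m → ℕ}
  {Y : ∀ N, Ω N → ℕ} {a b : Fin m → ℝ} {Ω' : Type*} [MeasurableSpace Ω'] {P' : Measure Ω'}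
  [IsProbabilityMeasure P'] {Z : Ω' → EuclideanSpace ℝ (Fin m)}

/-- With probability tending to one the mixing vector is in the regime of `mixingFilter`. -/
theorem tendsto_measure_of_mem_mixingFilter (hY : ∀ N, IsInversionStatistic (P N) (L N) (J N) (Y N))
    (hJ : TendstoInDistribution (fun N => normalizedMixing N b (J N)) atTop Z P P')
    {A : Set (ℕ × (Fin m → ℕ))} (hA : A ∈ mixingFilter L b) :
    Tendsto (fun N => P N {ω | (N, J N ω) ∉ A}) atTop (𝓝 0) := by
  rw [mixingFilter, mem_inf_principal] at hA
  obtain ⟨A₁, ⟨B₁, hB₁, hA₁⟩, A₂, ⟨B₂, hB₂, hA₂⟩, hA⟩ := mem_inf_iff_superset.1 hA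
  obtain ⟨δ, hδ, hball⟩ := Metric.mem_nhds_iff.1 hB₂
  have hc : Tendsto (fun N : ℕ => √(N : ℝ) * (δ / 2)) atTop atTop :=
    (Real.tendsto_sqrt_atTop.comp tendsto_natCast_atTop_atTop).atTop_mul_const (by positivity)
  refine tendsto_of_tendsto_of_tendsto_of_le_of_le' tendsto_const_nhds
    (tendsto_measure_lt_norm_of_tendstoInDistribution hJ hc)
    (Eventually.of_forall fun _ => zero_le) ?_
  filter_upwards [hB₁, eventually_gt_atTop 0] with N hN hN0
  refine measure_mono_ae ?_
  filter_upwards [(hY N).compatible] with ω hω hbad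
  by_contra hsmall
  refine hbad (hA ⟨hA₁ hN, hA₂ (hball ?_)⟩ hω)
  replace hsmall := not_lt.1 hsmall
  have hs : 0 < √(N : ℝ) := Real.sqrt_pos.2 (by exact_mod_cast hN0)
  refine lt_of_le_of_lt ((dist_pi_le_iff (by positivity)).2 fun k => ?_) (half_lt_self hδ)
  rw [Real.dist_eq]
  exact le_of_mul_le_mul_left
    ((abs_div_sub_le_norm_normalizedMixing hN0 b (J N) ω k).trans hsmall) hs

/-- The existence of `L N`-compatible `j` with `j / N` close to `b`, as a consequence of their
having probability tending to one; deterministic limits may therefore be taken along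
`mixingFilter`. -/
theorem mixingFilter_neBot (hY : ∀ N, IsInversionStatistic (P N) (L N) (J N) (Y N))
    (hJ : TendstoInDistribution (fun N => normalizedMixing N b (J N)) atTop Z P P') :
    (mixingFilter L b).NeBot := by
  refine ⟨fun h => ?_⟩
  have := tendsto_measure_of_mem_mixingFilter hY hJ (A := ∅) (by rw [h]; exact mem_bot)
  simp at this

/-- A function which converges in the regime of `mixingFilter` may be replaced by its limit under
the integral, by bounded convergence in probability. -/
theorem tendsto_integral_sub_of_tendsto_mixingFilter
    (hY : ∀ N, IsInversionStatistic (P N) (L N) (J N) (Y N))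
    (hJ : TendstoInDistribution (fun N => normalizedMixing N b (J N)) atTop Z P P')
    {f g : ℕ → (Fin m → ℕ) → ℂ} {c : ℂ}
    (hf : Tendsto (fun p : ℕ × (Fin m → ℕ) => f p.1 p.2) (mixingFilter L b) (𝓝 c))
    (hf1 : ∀ N, ∀ᵐ ω ∂(P N), ‖f N (J N ω)‖ ≤ 1) (hg : ∀ N j, ‖g N j‖ ≤ 1) :
    Tendsto (fun N => (∫ ω, f N (J N ω) * g N (J N ω) ∂(P N)) - c * ∫ ω, g N (J N ω) ∂(P N))
      atTop (𝓝 0) := by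
  rw [Metric.tendsto_nhds]
  intro ε hε
  set C : ℝ := 1 + ‖c‖ with hC
  have hC0 : 0 < C := by positivity
  have hA := hf.eventually (Metric.closedBall_mem_nhds c (half_pos hε))
  have hlim := (ENNReal.tendsto_toReal ENNReal.zero_ne_top).comp
    (tendsto_measure_of_mem_mixingFilter hY hJ hA)
  have hsm : ∀ᶠ N in atTop, (P N).real {ω | (N, J N ω) ∉ {p : ℕ × (Fin m → ℕ) |
      f p.1 p.2 ∈ Metric.closedBall c (ε / 2)}} < ε / (2 * C) :=
    hlim.eventually_lt_const (by simp; positivity)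
  filter_upwards [hsm] with N hN
  set bad : Set (Ω N) := {ω | (N, J N ω) ∉ {p : ℕ × (Fin m → ℕ) |
      f p.1 p.2 ∈ Metric.closedBall c (ε / 2)}} with hbad
  have hJm := (hY N).measurable_mixing
  have hbm : MeasurableSet bad := hJm
    (Set.to_countable {j | (N, j) ∉ {p : ℕ × (Fin m → ℕ) |
      f p.1 p.2 ∈ Metric.closedBall c (ε / 2)}}).measurableSet
  have hcomp : ∀ φ : (Fin m → ℕ) → ℂ, AEStronglyMeasurable (fun ω => φ (J N ω)) (P N) :=
    fun φ => ((measurable_of_countable φ).comp hJm).aestronglyMeasurable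
  have hgi : Integrable (fun ω => g N (J N ω)) (P N) :=
    Integrable.of_bound (hcomp _) 1 (Eventually.of_forall fun ω => hg N _)
  have hfgi : Integrable (fun ω => f N (J N ω) * g N (J N ω)) (P N) := by
    refine Integrable.of_bound (hcomp fun j => f N j * g N j) 1 ?_
    filter_upwards [hf1 N] with ω hω
    rw [norm_mul]
    exact mul_le_one₀ hω (norm_nonneg _) (hg _ _)
  have hbi : Integrable (fun ω => ε / 2 + bad.indicator (fun _ => C) ω) (P N) :=
    (integrable_const _).add ((integrable_const _).indicator hbm)
  rw [dist_zero_right, ← integral_const_mul, ← integral_sub hfgi (hgi.const_mul c)]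
  refine (norm_integral_le_of_norm_le hbi ?_).trans_lt ?_
  · filter_upwards [hf1 N] with ω hω
    rw [← sub_mul, norm_mul]
    refine (mul_le_of_le_one_right (norm_nonneg _) (hg _ _)).trans ?_
    by_cases hb : ω ∈ bad
    · rw [Set.indicator_of_mem hb]
      exact (norm_sub_le _ _).trans (by linarith)
    · rw [Set.indicator_of_notMem hb, add_zero, ← dist_eq_norm]
      simpa [hbad] using hb
  · rw [integral_add (integrable_const _) ((integrable_const _).indicator hbm), integral_const,
      integral_indicator_const _ hbm, probReal_univ, one_smul, smul_eq_mul]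
    have h1 : (P N).real bad * C < ε / (2 * C) * C := mul_lt_mul_of_pos_right hN hC0
    have h2 : ε / (2 * C) * C = ε / 2 := by field_simp
    linarith

theorem tendsto_fst_mixingFilter : Tendsto Prod.fst (mixingFilter L b) atTop :=
  tendsto_comap.mono_left (inf_le_left.trans inf_le_left)

theorem tendsto_snd_div_mixingFilter (k : Fin m) :
    Tendsto (fun p : ℕ × (Fin m → ℕ) => (p.2 k : ℝ) / p.1) (mixingFilter L b) (𝓝 (b k)) :=
  tendsto_pi_nhds.1 ((tendsto_comap
    (f := fun (p : ℕ × (Fin m → ℕ)) k => (p.2 k : ℝ) / p.1)).mono_left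
    (inf_le_left.trans inf_le_right)) k

theorem eventually_compatible_mixingFilter :
    ∀ᶠ p : ℕ × (Fin m → ℕ) in mixingFilter L b, Compatible (L p.1) p.2 :=
  (inf_le_right : mixingFilter L b ≤ _) (mem_principal_self _)

end Sequence

/-! ### Joint convergence -/

/-- Compatibility survives in the limit as `b_i ≤ a_i + b_{i+1}`, so all factors of `limVar` are
nonnegative. -/
theorem limVar_nonneg_of_neBot {m : ℕ} {L : ℕ → Fin m → ℕ} {a b : Fin m → ℝ}
    [(mixingFilter L b).NeBot]
    (ha : Tendsto (fun (N : ℕ) (i : Fin m) => (L N i : ℝ) / N) atTop (𝓝 a)) (hb : ∀ i, 0 ≤ b i) :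
    0 ≤ limVar a b := by
  have ha' := tendsto_pi_nhds.1 ha
  have ha0 : ∀ i, 0 ≤ a i := fun i =>
    ge_of_tendsto (ha' i) (Eventually.of_forall fun N => by positivity)
  have hs0 : ∀ i, 0 ≤ shift b i := fun i => by
    unfold shift
    split_ifs
    exacts [hb _, le_rfl]
  have hle : ∀ i, b i ≤ a i + shift b i := fun i => by
    refine le_of_tendsto_of_tendsto (tendsto_snd_div_mixingFilter (L := L) i)
      (((ha' i).comp tendsto_fst_mixingFilter).add
        (tendsto_shift (fun k => tendsto_snd_div_mixingFilter (L := L) k) i)) ?_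
    filter_upwards [eventually_compatible_mixingFilter] with p hp
    simp only [Function.comp_apply]
    rw [← add_div]
    gcongr
    exact_mod_cast hp i
  unfold limVar
  refine mul_nonneg (by norm_num) (Finset.sum_nonneg fun i _ => ?_)
  exact mul_nonneg (mul_nonneg (sub_nonneg.2 (hle i)) (hb i)) (add_nonneg (ha0 i) (hs0 i))

theorem aemeasurable_restInversion {m : ℕ} {Ω : Type*} [MeasurableSpace Ω] {P : Measure Ω}
    {L : Fin m → ℕ} {J : Ω → Fin m → ℕ} {Y : Ω → ℕ} (h : IsInversionStatistic P L J Y) :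
    AEMeasurable (restInversion P J Y) P :=
  (measurable_from_top.comp h.measurable_stat).aemeasurable.sub
    (stronglyMeasurable_condExp.mono h.measurable_mixing.comap_le).measurable.aemeasurable

/-- The joint characteristic function as a mixture: conditionally on the mixing vector, the
rest-inversion part contributes the factor `invCharFun`. -/
theorem charFun_map_restInversion_prod {m : ℕ} {Ω : Type*} [MeasurableSpace Ω] {P : Measure Ω}
    [IsProbabilityMeasure P] {L : Fin m → ℕ} {J : Ω → Fin m → ℕ} {Y : Ω → ℕ}
    (h : IsInversionStatistic P L J Y) {N : ℕ} {b : Fin m → ℝ}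
    (hZ : AEMeasurable (normalizedMixing N b J) P) (r : ℝ)
    (t : WithLp 2 (ℝ × EuclideanSpace ℝ (Fin m))) :
    charFun (P.map fun ω => WithLp.toLp 2 (restInversion P J Y ω / r, normalizedMixing N b J ω)) t
      = ∫ ω, invCharFun L (J ω) (t.fst / r) *
          Complex.exp (inner ℝ (normalizedMixing N b id (J ω)) t.snd * Complex.I) ∂P := by
  have hR := aemeasurable_restInversion h
  have hm : AEMeasurable
      (fun ω => WithLp.toLp 2 (restInversion P J Y ω / r, normalizedMixing N b J ω)) P :=
    (WithLp.measurable_toLp 2 _).comp_aemeasurable ((hR.div_const r).prodMk hZ)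
  rw [charFun_apply, integral_map hm (by fun_prop), ← h.integral_exp_restInversion_mul (t.fst / r)
    (g := fun j => Complex.exp (inner ℝ (normalizedMixing N b id j) t.snd * Complex.I))
    fun j => (Complex.norm_exp_ofReal_mul_I _).le]
  congr 1 with ω
  rw [← Complex.exp_add, WithLp.prod_inner_apply]
  congr 1
  have hz : normalizedMixing N b id (J ω) = normalizedMixing N b J ω := rfl
  simp only [hz, RCLike.inner_apply, conj_trivial, WithLp.ofLp_fst, WithLp.ofLp_snd]
  push_cast
  ring

end Supernomial

theorem mainTheorem5 {m : ℕ} {Ω : ℕ → Type*} [∀ N, MeasurableSpace (Ω N)]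
    (P : ∀ N, Measure (Ω N)) [∀ N, IsProbabilityMeasure (P N)]
    (L : ℕ → Fin m → ℕ) (J : ∀ N, Ω N → Fin m → ℕ) (Y : ∀ N, Ω N → ℕ)
    (hY : ∀ N, Supernomial.IsInversionStatistic (P N) (L N) (J N) (Y N))
    (a b : Fin m → ℝ) (S : Matrix (Fin m) (Fin m) ℝ)
    (ha : Tendsto (fun (N : ℕ) (i : Fin m) => (L N i : ℝ) / N) atTop (𝓝 a)) (ha0 : a ≠ 0)
    (hb : ∀ i, 0 ≤ b i) (hS : S.PosSemidef) (hrank : 0 < S.rank)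
    (hJ : TendstoInDistribution (fun N => Supernomial.normalizedMixing N b (J N)) atTop id P
      (multivariateGaussian 0 S)) :
    0 ≤ Supernomial.limVar a b ∧
    TendstoInDistribution
      (fun N ω => (Supernomial.restInversion (P N) (J N) (Y N) ω / (N : ℝ) ^ (3 / 2 : ℝ),
        Supernomial.normalizedMixing N b (J N) ω))
      atTop id P
      ((gaussianReal 0 (Supernomial.limVar a b).toNNReal).prod (multivariateGaussian 0 S)) := by
  have := Supernomial.mixingFilter_neBot hY hJ
  have hv : 0 ≤ Supernomial.limVar a b := Supernomial.limVar_nonneg_of_neBot ha hb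
  refine ⟨hv, ?_⟩
  have hmeas := fun N : ℕ => ((Supernomial.aemeasurable_restInversion (hY N)).div_const
    ((N : ℝ) ^ (3 / 2 : ℝ))).prodMk (hJ.forall_aemeasurable N)
  -- Lévy's theorem lives on an inner product space, so the pair is viewed in the `L²` product.
  have key : TendstoInDistribution
      (fun N ω => WithLp.toLp 2
        (Supernomial.restInversion (P N) (J N) (Y N) ω / (N : ℝ) ^ (3 / 2 : ℝ),
          Supernomial.normalizedMixing N b (J N) ω))
      atTop (WithLp.toLp 2) P
      ((gaussianReal 0 (Supernomial.limVar a b).toNNReal).prod (multivariateGaussian 0 S)) := by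
    refine ⟨fun N => (WithLp.measurable_toLp 2 _).comp_aemeasurable (hmeas N),
      (WithLp.measurable_toLp 2 _).aemeasurable,
      ProbabilityMeasure.tendsto_of_tendsto_charFun fun t => ?_⟩
    simp only [ProbabilityMeasure.coe_mk]
    rw [charFun_prod]
    have hZ : Tendsto (fun N => ∫ ω, Complex.exp
        (inner ℝ (Supernomial.normalizedMixing N b id (J N ω)) t.snd * Complex.I) ∂(P N)) atTop
        (𝓝 (charFun (multivariateGaussian 0 S) t.snd)) := by
      have h := ProbabilityMeasure.tendsto_iff_tendsto_charFun.1 hJ.tendsto t.snd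
      simp only [ProbabilityMeasure.coe_mk, Measure.map_id] at h
      refine h.congr fun N => ?_
      rw [charFun_apply, integral_map (hJ.forall_aemeasurable N) (by fun_prop)]
      rfl
    have hgauss : charFun (gaussianReal 0 (Supernomial.limVar a b).toNNReal) t.fst
        = Complex.exp (-(t.fst ^ 2 * Supernomial.limVar a b / 2) : ℝ) := by
      rw [charFun_gaussianReal, Real.coe_toNNReal _ hv]
      congr 1
      push_cast
      ring
    have hφ := Supernomial.tendsto_invCharFun Supernomial.tendsto_fst_mixingFilter
      (fun k => (tendsto_pi_nhds.1 ha k).comp Supernomial.tendsto_fst_mixingFilter)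
      (fun k => Supernomial.tendsto_snd_div_mixingFilter (L := L) (b := b) k)
      Supernomial.eventually_compatible_mixingFilter t.fst
    have hdiff := Supernomial.tendsto_integral_sub_of_tendsto_mixingFilter hY hJ
      (f := fun N j => Supernomial.invCharFun (L N) j (t.fst / (N : ℝ) ^ (3 / 2 : ℝ)))
      (g := fun N j => Complex.exp
        (inner ℝ (Supernomial.normalizedMixing N b id j) t.snd * Complex.I)) hφ
      (fun N => (hY N).ae_norm_invCharFun_le _) fun N j => (Complex.norm_exp_ofReal_mul_I _).le
    have h := hdiff.add (hZ.const_mul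
      (Complex.exp (-(t.fst ^ 2 * Supernomial.limVar a b / 2) : ℝ)))
    rw [zero_add, ← hgauss] at h
    refine h.congr fun N => ?_
    rw [Supernomial.charFun_map_restInversion_prod (hY N) (hJ.forall_aemeasurable N), hgauss,
      sub_add_cancel]
  exact key.continuous_comp (WithLp.prod_continuous_ofLp 2 _ _)
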